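/- Let $L\in\mathbb R^{n\times n}$, $B\in\mathbb R^{n\times d}$ (in particular $d=n$) and $X_0\in\mathbb R^n$ be deterministic, let $(W_t)_{t\ge 0}$ be a standard $d$-dimensional Wiener process, and let $X_t$ be the solution of the linear stochastic differential equation with additive noise $$dX_t = L X_t\,dt + B\,dW_t$$ with initial value $X_0$, i.e. $X$ has almost surely continuous paths and almost surely $X_t = X_0+\int_0^t L X_s\,ds + \int_0^t B\,dW_s$ for all $t\ge 0$, where $\int_0^t B\,dW_s=B(W_t-W_0)$. For $k\ge 1$ let $\lambda_k=(k-\tfrac12)\pi$ be the Karhunen–Loève frequencies of the Wiener process on $[0,1]$, and let $$\varphi^{\cos}_{k,t}(L)=\int_0^t e^{(t-s)L}\cos(\lambda_k s)\,ds ,$$ the matrix function corresponding to $\varphi^{\cos}_{k,t}(z)=\dfrac{z e^{zt}-z\cos(\lambda_k t)+\lambda_k\sin(\lambda_k t)}{z^2+\lambda_k^2}$. Then for every $t\in[0,1]$: 1. $X_t$ is integrable and $\mathbb E(X_t)=e^{tL}X_0$; 2. $\|X_t\|^2$ is integrable, the series below converges, and $$\mathbb E\big(\|X_t\|^2\big)=\|e^{tL}X_0\|^2+2\sum_{k=1}^\infty\big\|\varphi^{\cos}_{k,t}(L)B\big\|_F^2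 ,$$ where $\|\cdot\|$ is the Euclidean norm and $\|\cdot\|_F$ the Frobenius norm. -/

import Mathlib

open MeasureTheory ProbabilityTheory
open scoped NNReal

/-- `W` is a standard `d`-dimensional Wiener process under `P`: its components are independent
standard real Brownian motions. -/
structure IsStandardWiener {Ω : Type*} [MeasurableSpace Ω] {d : ℕ} (P : Measure Ω)
    (W : ℝ≥0 → Ω → EuclideanSpace ℝ (Fin d)) : Prop where
  brownian : ∀ i : Fin d, IsBrownianReal (fun t ω ↦ W t ω i) P
  indep : iIndepFun (fun (i : Fin d) ω (t : ℝ≥0) ↦ W t ω i) P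

/-- `X` is a solution of `dX_t = L X_t dt + B dW_t` with deterministic initial value `x₀`: its paths
are almost surely continuous and almost surely
`X_t = x₀ + ∫₀ᵗ L X_s ds + ∫₀ᵗ B dW_s` for all `t ≥ 0`.
As `B` is constant, every Riemann sum of the stochastic integral `∫₀ᵗ B dW_s`, hence the integral
itself, equals `B (W_t - W_0)`. -/
structure IsLinearSDESolution {Ω : Type*} [MeasurableSpace Ω] {n d : ℕ} (P : Measure Ω)
    (L : Matrix (Fin n) (Fin n) ℝ) (B : Matrix (Fin n) (Fin d) ℝ)
    (W : ℝ≥0 → Ω → EuclideanSpace ℝ (Fin d)) (x₀ : EuclideanSpace ℝ (Fin n))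
    (X : ℝ≥0 → Ω → EuclideanSpace ℝ (Fin n)) : Prop where
  cont : ∀ᵐ ω ∂P, Continuous (fun t ↦ X t ω)
  eqn : ∀ᵐ ω ∂P, ∀ t : ℝ≥0,
    X t ω = x₀ + (∫ s in (0 : ℝ)..t, Matrix.toEuclideanLin L (X s.toNNReal ω))
      + Matrix.toEuclideanLin B (W t ω - W 0 ω)

/-- The Karhunen–Loève frequencies `λ_k = (k - 1/2) π`, `k = 1, 2, …`, of the Wiener process. -/
noncomputable def klFreq (k : ℕ) : ℝ := ((k : ℝ) - 1 / 2) * Real.pi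

/-- The trigonometric `φ` function `φ^cos_{k,t}` at a matrix, the entrywise integral
`φ^cos_{k,t}(L) = ∫₀ᵗ e^{(t-s)L} cos(λ_k s) ds`. -/
noncomputable def phiCos {n : ℕ} (k : ℕ) (t : ℝ) (L : Matrix (Fin n) (Fin n) ℝ) :
    Matrix (Fin n) (Fin n) ℝ :=
  Matrix.of fun i j ↦
    ∫ s in (0 : ℝ)..t, NormedSpace.exp ((t - s) • L) i j * Real.cos (klFreq k * s)

open scoped Matrix.Norms.Frobenius in
/-- The Frobenius norm of a real matrix. -/
noncomputable def frobNorm {n d : ℕ} (A : Matrix (Fin n) (Fin d) ℝ) : ℝ := ‖A‖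

open scoped Matrix.Norms.Frobenius in
theorem hasDerivAt_exp_entry {n : ℕ} (t : ℝ) (L : Matrix (Fin n) (Fin n) ℝ) (i j : Fin n) (s : ℝ) :
    HasDerivAt (fun s : ℝ ↦ NormedSpace.exp ((t - s) • L) i j)
      (-(NormedSpace.exp ((t - s) • L) * L) i j) s := by
  have h1 := hasDerivAt_exp_smul_const (𝕂 := ℝ) L (t - s)
  have h2 : HasDerivAt (fun s : ℝ ↦ t - s) (-1) s := by
    simpa using (hasDerivAt_id s).const_sub t
  have h3 := h1.scomp s h2
  have h4 := ((LinearMap.toContinuousLinearMap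
    (Matrix.entryLinearMap ℝ ℝ i j : Matrix (Fin n) (Fin n) ℝ →ₗ[ℝ] ℝ)).hasFDerivAt).comp_hasDerivAt
    s h3
  refine h4.congr_deriv ?_
  change ((-1 : ℝ) • (NormedSpace.exp ((t - s) • L) * L)) i j = _
  simp

/-- The integral-free description of `φ^cos_{k,t}`, that is
`φ^cos_{k,t}(z) = (z e^{zt} - z cos(λ_k t) + λ_k sin(λ_k t)) / (z² + λ_k²)`, with the denominator
multiplied out. -/
theorem phiCos_mul {n : ℕ} (k : ℕ) (t : ℝ) (L : Matrix (Fin n) (Fin n) ℝ) :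
    phiCos k t L * (L ^ 2 + klFreq k ^ 2 • (1 : Matrix (Fin n) (Fin n) ℝ)) =
      NormedSpace.exp (t • L) * L - Real.cos (klFreq k * t) • L
        + (klFreq k * Real.sin (klFreq k * t)) • (1 : Matrix (Fin n) (Fin n) ℝ) := by
  set l := klFreq k with hl
  have hE := hasDerivAt_exp_entry t L
  have hEL : ∀ i j (s : ℝ), HasDerivAt (fun s : ℝ ↦ (NormedSpace.exp ((t - s) • L) * L) i j)
      (-(NormedSpace.exp ((t - s) • L) * L ^ 2) i j) s := fun i j s ↦ by
    have h := HasDerivAt.fun_sum (u := Finset.univ) fun (m : Fin n) _ ↦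
      (hE i m s).mul_const (L m j)
    refine (h.congr_deriv ?_).congr_of_eventuallyEq (.of_forall fun s ↦ Matrix.mul_apply)
    rw [pow_two, ← mul_assoc, Matrix.mul_apply]
    simp [Finset.sum_neg_distrib]
  have hcont : ∀ i j, Continuous fun s : ℝ ↦ NormedSpace.exp ((t - s) • L) i j := fun i j ↦
    continuous_iff_continuousAt.2 fun s ↦ (hE i j s).continuousAt
  have hs : ∀ s : ℝ, HasDerivAt (fun s : ℝ ↦ l * Real.sin (l * s)) (l ^ 2 * Real.cos (l * s)) s :=
    fun s ↦ by
      have h := (((hasDerivAt_id s).const_mul l).sin).const_mul l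
      refine h.congr_deriv ?_
      simp only [id]
      ring
  have hc : ∀ s : ℝ, HasDerivAt (fun s : ℝ ↦ Real.cos (l * s)) (-(l * Real.sin (l * s))) s :=
    fun s ↦ by
      have h := ((hasDerivAt_id s).const_mul l).cos
      refine h.congr_deriv ?_
      simp only [id]
      ring
  ext i j
  have hF : ∀ s : ℝ, HasDerivAt
      (fun s : ℝ ↦ NormedSpace.exp ((t - s) • L) i j * (l * Real.sin (l * s))
        - (NormedSpace.exp ((t - s) • L) * L) i j * Real.cos (l * s))
      ((NormedSpace.exp ((t - s) • L) * (L ^ 2 + l ^ 2 • (1 : Matrix (Fin n) (Fin n) ℝ))) i j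
        * Real.cos (l * s)) s := fun s ↦ by
    have h := ((hE i j s).mul (hs s)).sub ((hEL i j s).mul (hc s))
    refine h.congr_deriv ?_
    simp [mul_add]
    ring
  have hi : ∀ m, IntervalIntegrable
      (fun s : ℝ ↦ NormedSpace.exp ((t - s) • L) i m * Real.cos (l * s)) volume 0 t := fun m ↦
    ((hcont i m).mul (by fun_prop)).intervalIntegrable 0 t
  have hsum : ∀ s : ℝ,
      (NormedSpace.exp ((t - s) • L) * (L ^ 2 + l ^ 2 • (1 : Matrix (Fin n) (Fin n) ℝ))) i j
        * Real.cos (l * s) = ∑ m, NormedSpace.exp ((t - s) • L) i m * Real.cos (l * s) *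
          (L ^ 2 + l ^ 2 • (1 : Matrix (Fin n) (Fin n) ℝ)) m j := fun s ↦ by
    rw [Matrix.mul_apply, Finset.sum_mul]
    exact Finset.sum_congr rfl fun m _ ↦ by ring
  have hint := intervalIntegral.integral_eq_sub_of_hasDerivAt (a := 0) (b := t) (fun s _ ↦ hF s)
    (by
      simp_rw [hsum]
      exact (continuous_finsetSum _ fun m _ ↦
        (((hcont i m).mul (by fun_prop)).mul continuous_const)).intervalIntegrable 0 t)
  simp_rw [hsum] at hint
  rw [intervalIntegral.integral_finsetSum fun m _ ↦ (hi m).mul_const _] at hint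
  simp_rw [intervalIntegral.integral_mul_const] at hint
  rw [Matrix.mul_apply]
  simp only [phiCos, Matrix.of_apply, ← hl]
  rw [hint]
  simp [Matrix.one_apply]
  ring

/-! By variation of constants, almost surely `X_t = e^{tL} x₀ + ∫₀ᵗ e^{(t-s)L} B dW_s`. The
integrand is smooth and deterministic, so integrating by parts turns the stochastic integral into
ordinary integrals of the Wiener paths (`variation_of_constants`, `ae_eq_sum_wienerIntegral`).
Fubini then reduces every moment to the covariances of `W`: the Wiener integrals are centred, those
against distinct components are orthogonal, and `E(w_r w_s) = min r s` gives the Itô isometry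
(`integral_wienerIntegral_sq`). Hence the variance is the sum over all entries `g` of `e^{(t-s)L} B`
of `∫₀ᵗ g²`.

The functions `√2 cos(λ_k s)` form an orthonormal basis of `L²[0,1]`. Parseval for `g` cut off at `t
≤ 1` turns `∫₀ᵗ g²` into twice the sum of the squared cosine coefficients
(`hasSum_sq_integral_cos_klFreq`), which are the entries of `φ^cos_{k,t}(L) B`. -/

/-! ### Parseval for the half-integer cosines -/

/-- The integral over `[-1, 1]` folded onto `[0, 1]`. -/
theorem integral_neg_one_one_eq_fold {E : Type*} [NormedAddCommGroup E] [NormedSpace ℝ E]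
    {F : ℝ → E} (hF : IntervalIntegrable F volume (-1) 1) :
    ∫ x in (-1 : ℝ)..1, F x = ∫ x in (0 : ℝ)..1, (F x + F (-x)) := by
  have h1 : IntervalIntegrable F volume (-1) 0 :=
    hF.mono_set (by rw [Set.uIcc_of_le (by norm_num), Set.uIcc_of_le (by norm_num)]
                    exact Set.Icc_subset_Icc_right (by norm_num))
  have h2 : IntervalIntegrable F volume 0 1 :=
    hF.mono_set (by rw [Set.uIcc_of_le (by norm_num), Set.uIcc_of_le (by norm_num)]
                    exact Set.Icc_subset_Icc_left (by norm_num))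
  have h3 : IntervalIntegrable (fun x ↦ F (-x)) volume 0 1 := by
    have h := ((IntervalIntegrable.comp_sub_left_iff (f := F) (a := -1) (b := 0) 0).2 h1).symm
    simpa using h
  have h4 : ∫ x in (0 : ℝ)..1, F (-x) = ∫ x in (-1 : ℝ)..0, F x := by
    rw [intervalIntegral.integral_comp_neg]; simp
  rw [← intervalIntegral.integral_add_adjacent_intervals h1 h2,
    intervalIntegral.integral_add h2 h3, h4, add_comm]

/-- The indices `-n` and `n + 1` have opposite frequencies, so a sum over the integers counts each
Karhunen–Loève frequency twice. -/
theorem cos_neg_sub_half_mul_pi (n : ℕ) (x : ℝ) :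
    Real.cos ((((-n : ℤ) : ℝ) - 1 / 2) * Real.pi * x) = Real.cos (klFreq (n + 1) * x) := by
  rw [← Real.cos_neg, klFreq]
  congr 1
  push_cast
  ring

/-- Parseval's identity for the half-integer cosines, indexed by the integers. -/
theorem hasSum_sq_integral_cos_int {φ : ℝ → ℝ} {C : ℝ} (hφ : Measurable φ)
    (hb : ∀ x ∈ Set.Icc (0 : ℝ) 1, |φ x| ≤ C) :
    HasSum (fun n : ℤ ↦ (∫ x in (0 : ℝ)..1, φ x * Real.cos (((n : ℝ) - 1 / 2) * Real.pi * x)) ^ 2)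
      (∫ x in (0 : ℝ)..1, φ x ^ 2) := by
  -- The even extension of `φ` times `e^{iπx/2}`: the phase shifts the period-2 frequencies `nπ` to
  -- `(n - 1/2)π`, and evenness leaves only cosines in the Fourier coefficients.
  set F : ℝ → ℂ := fun x ↦ (φ |x| : ℂ) * Complex.exp (Real.pi / 2 * x * Complex.I) with hFdef
  have hlt : (-1 : ℝ) < 1 := by norm_num
  have hFm : Measurable F := by fun_prop
  have hnorm : ∀ x, ‖F x‖ = |φ (|x|)| := fun x ↦ by
    have : (Real.pi / 2 * x * Complex.I : ℂ) = ((Real.pi / 2 * x : ℝ) : ℂ) * Complex.I := by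
      push_cast; ring
    rw [hFdef]
    simp only
    rw [norm_mul, this, Complex.norm_exp_ofReal_mul_I, mul_one, Complex.norm_real, Real.norm_eq_abs]
  have hbF : ∀ᵐ x ∂(volume.restrict (Set.Ioc (-1 : ℝ) 1)), ‖F x‖ ≤ C := by
    refine (ae_restrict_iff' measurableSet_Ioc).2 (.of_forall fun x hx ↦ ?_)
    rw [hnorm]
    exact hb _ ⟨abs_nonneg x, abs_le.2 ⟨hx.1.le, hx.2⟩⟩
  have hL : ∀ p, MemLp F p (volume.restrict (Set.Ioc (-1 : ℝ) 1)) := fun p ↦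
    MemLp.of_bound hFm.aestronglyMeasurable C hbF
  have hP := hasSum_sq_fourierCoeffOn hlt (hL 2)
  have hFi : IntervalIntegrable F volume (-1) 1 :=
    (intervalIntegrable_iff_integrableOn_Ioc_of_le hlt.le).2
      ((hL 1).integrable le_rfl)
  convert hP using 1
  · ext n
    have : fourierCoeffOn hlt F n = ((∫ x in (0 : ℝ)..1,
        φ x * Real.cos (((n : ℝ) - 1 / 2) * Real.pi * x) : ℝ) : ℂ) := by
      rw [fourierCoeffOn_eq_integral, ← intervalIntegral.integral_ofReal]
      have hfc : Continuous fun x : ℝ ↦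
          (fourier (-n) (x : AddCircle ((1 : ℝ) - -1)) : ℂ) :=
        (fourier (-n)).continuous.comp (AddCircle.continuous_mk' _)
      rw [integral_neg_one_one_eq_fold]
      · rw [← intervalIntegral.integral_smul]
        refine intervalIntegral.integral_congr fun x hx ↦ ?_
        rw [Set.uIcc_of_le zero_le_one] at hx
        simp only [hFdef, abs_neg, abs_of_nonneg hx.1, fourier_coe_apply, smul_eq_mul]
        push_cast
        rw [Complex.cos]
        have e1 : Complex.exp (((n : ℂ) - 1 / 2) * Real.pi * x * Complex.I)
            = Complex.exp (2 * Real.pi * Complex.I * (-n : ℂ) * (-x) / (1 - -1)) *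
              Complex.exp (Real.pi / 2 * -x * Complex.I) := by
          rw [← Complex.exp_add]; congr 1; ring
        have e2 : Complex.exp (-(((n : ℂ) - 1 / 2) * Real.pi * x) * Complex.I)
            = Complex.exp (2 * Real.pi * Complex.I * (-n : ℂ) * x / (1 - -1)) *
              Complex.exp (Real.pi / 2 * x * Complex.I) := by
          rw [← Complex.exp_add]; congr 1; ring
        rw [e1, e2, Complex.real_smul]
        push_cast
        ring
      · simp only [smul_eq_mul]
        exact hFi.continuousOn_mul hfc.continuousOn
    rw [this, Complex.norm_real, Real.norm_eq_abs, sq_abs]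
  · have hi : IntervalIntegrable (fun x ↦ ‖F x‖ ^ 2) volume (-1) 1 :=
      (intervalIntegrable_iff_integrableOn_Ioc_of_le hlt.le).2 (hL 2).norm.integrable_sq
    rw [integral_neg_one_one_eq_fold hi, ← intervalIntegral.integral_smul]
    refine intervalIntegral.integral_congr fun x hx ↦ ?_
    rw [Set.uIcc_of_le zero_le_one] at hx
    simp only [hnorm, abs_neg, abs_of_nonneg hx.1, sq_abs, smul_eq_mul]
    ring

/-- Parseval's identity for the Karhunen–Loève cosines and a function supported on `[0, t]`. -/
theorem hasSum_sq_integral_cos_klFreq {g : ℝ → ℝ} (hg : Continuous g) {t : ℝ} (ht0 : 0 ≤ t)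
    (ht : t ≤ 1) :
    HasSum (fun k : ℕ ↦ (∫ s in (0 : ℝ)..t, g s * Real.cos (klFreq (k + 1) * s)) ^ 2)
      (1 / 2 * ∫ s in (0 : ℝ)..t, g s ^ 2) := by
  obtain ⟨C, hC⟩ := (isCompact_Icc (a := (0 : ℝ)) (b := 1)).exists_bound_of_continuousOn
    hg.continuousOn
  have hcut : ∀ h : ℝ → ℝ, ∫ s in (0 : ℝ)..1, (Set.Iic t).indicator h s
      = ∫ s in (0 : ℝ)..t, h s := fun h ↦ by
    rw [intervalIntegral.integral_of_le zero_le_one, intervalIntegral.integral_of_le ht0,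
      setIntegral_indicator measurableSet_Iic, Set.Ioc_inter_Iic, min_eq_right ht]
  have h := hasSum_sq_integral_cos_int (φ := (Set.Iic t).indicator g) (C := C)
    (hg.measurable.indicator measurableSet_Iic) fun x hx ↦ by
      rw [← Real.norm_eq_abs]
      exact (norm_indicator_le_norm_self g x).trans (hC x hx)
  have e1 : ∀ c : ℝ, (∫ x in (0 : ℝ)..1, (Set.Iic t).indicator g x * Real.cos (c * x))
      = ∫ x in (0 : ℝ)..t, g x * Real.cos (c * x) := fun c ↦ by
    rw [← hcut]
    congr 1; ext x
    by_cases hx : x ∈ Set.Iic t <;> simp [hx]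
  have e2 : (∫ x in (0 : ℝ)..1, (Set.Iic t).indicator g x ^ 2)
      = ∫ x in (0 : ℝ)..t, g x ^ 2 := by
    rw [← hcut]
    congr 1; ext x
    by_cases hx : x ∈ Set.Iic t <;> simp [hx]
  simp_rw [e1] at h
  rw [e2] at h
  have h2 : ∀ n : ℕ, ∫ s in (0 : ℝ)..t, g s * Real.cos (((((n : ℤ) + 1 : ℤ) : ℝ) - 1 / 2)
      * Real.pi * s) = ∫ s in (0 : ℝ)..t, g s * Real.cos (klFreq (n + 1) * s) := fun n ↦ by
    simp [klFreq]
  have h3 : ∀ n : ℕ, ∫ s in (0 : ℝ)..t, g s * Real.cos ((((-n : ℤ) : ℝ) - 1 / 2)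
      * Real.pi * s) = ∫ s in (0 : ℝ)..t, g s * Real.cos (klFreq (n + 1) * s) := fun n ↦ by
    simp_rw [cos_neg_sub_half_mul_pi]
  -- After the shift by one, the pairing of `n` with `-(n + 1)` becomes that of `n + 1` with `-n`,
  -- two indices with equal cosine.
  have hs := (Equiv.addRight (1 : ℤ)).hasSum_iff.2 h
  have hs' := hs.nat_add_neg_add_one
  have hfin := hs'.mul_left (1 / 2)
  refine hfin.congr_fun fun n ↦ ?_
  simp only [Function.comp, Equiv.coe_addRight]
  rw [h2, show -((n : ℤ) + 1) + 1 = -n by ring, h3]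
  ring

/-! ### Measurability, integrability and Fubini for processes -/

/-- A process with almost surely continuous paths is jointly almost everywhere measurable. -/
theorem aemeasurable_uncurry_of_ae_continuous {Ω : Type*} [MeasurableSpace Ω] {P : Measure Ω}
    [SFinite P] {w : ℝ → Ω → ℝ} (hm : ∀ s, AEMeasurable (w s) P)
    (hc : ∀ᵐ ω ∂P, Continuous fun s ↦ w s ω) (μ : Measure ℝ) [SFinite μ] :
    AEMeasurable (fun p : ℝ × Ω ↦ w p.1 p.2) (μ.prod P) := by
  -- Only countably many grid times occur, so one null set suffices to replace all the samples by
  -- measurable versions.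
  choose F hFm hFe using fun (N : ℕ) (k : ℤ) ↦ hm ((k : ℝ) / (N + 1))
  have hF : ∀ N : ℕ, Measurable fun p : ℝ × Ω ↦ F N ⌊p.1 * (N + 1)⌋ p.2 := fun N ↦ by
    have h1 : Measurable fun q : Ω × ℤ ↦ F N q.2 q.1 :=
      measurable_from_prod_countable_left (hFm N)
    have h2 : Measurable fun p : ℝ × Ω ↦ (p.2, ⌊p.1 * (N + 1)⌋) :=
      measurable_snd.prodMk (Int.measurable_floor.comp (by fun_prop))
    exact h1.comp h2
  refine aemeasurable_of_tendsto_metrizable_ae' (fun N ↦ (hF N).aemeasurable) ?_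
  have hae : ∀ᵐ ω ∂P, (Continuous fun s ↦ w s ω) ∧
      ∀ (N : ℕ) (k : ℤ), w ((k : ℝ) / (N + 1)) ω = F N k ω :=
    hc.and (ae_all_iff.2 fun N ↦ ae_all_iff.2 fun k ↦ hFe N k)
  have hae' := (Measure.quasiMeasurePreserving_snd (μ := μ) (ν := P)).ae hae
  filter_upwards [hae'] with p hp
  simp_rw [← hp.2]
  refine (hp.1.tendsto p.1).comp ?_
  rw [tendsto_iff_dist_tendsto_zero]
  refine squeeze_zero (fun _ ↦ dist_nonneg) (fun N ↦ ?_) tendsto_one_div_add_atTop_nhds_zero_nat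
  have hN : (0 : ℝ) < N + 1 := by positivity
  rw [Real.dist_eq, abs_le]
  have h1 := Int.floor_le (p.1 * (N + 1))
  have h2 := Int.lt_floor_add_one (p.1 * (N + 1))
  constructor
  · rw [neg_le_sub_iff_le_add, ← add_div, le_div_iff₀ hN]; exact h2.le
  · have : (⌊p.1 * (N + 1)⌋ : ℝ) / (N + 1) ≤ p.1 := (div_le_iff₀ hN).2 h1
    have : 0 ≤ 1 / ((N : ℝ) + 1) := by positivity
    linarith

/-- The Cauchy–Schwarz inequality against the constant function. -/
theorem sq_integral_le_mul_integral_sq {f : ℝ → ℝ} {t : ℝ} (ht : 0 ≤ t) (hf : Continuous f) :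
    (∫ s in (0 : ℝ)..t, f s) ^ 2 ≤ t * ∫ s in (0 : ℝ)..t, f s ^ 2 := by
  set m := ∫ s in (0 : ℝ)..t, f s with hm
  have hi : ∀ h : ℝ → ℝ, Continuous h → IntervalIntegrable h volume 0 t :=
    fun h hh ↦ hh.intervalIntegrable 0 t
  -- The variance of `f`, scaled by `t` to avoid dividing; `t = 0` is treated apart.
  have h0 : 0 ≤ ∫ s in (0 : ℝ)..t, (t * f s - m) ^ 2 :=
    intervalIntegral.integral_nonneg ht fun s _ ↦ sq_nonneg _
  have h1 : ∫ s in (0 : ℝ)..t, (t * f s - m) ^ 2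
      = t * (t * (∫ s in (0 : ℝ)..t, f s ^ 2) - m ^ 2) := by
    have : ∀ s, (t * f s - m) ^ 2 = t ^ 2 * f s ^ 2 - 2 * t * m * f s + m ^ 2 := fun s ↦ by ring
    simp_rw [this]
    rw [intervalIntegral.integral_add (hi _ (by fun_prop)) (hi _ (by fun_prop)),
      intervalIntegral.integral_sub (hi _ (by fun_prop)) (hi _ (by fun_prop)),
      intervalIntegral.integral_const_mul, intervalIntegral.integral_const_mul, ← hm,
      intervalIntegral.integral_const, smul_eq_mul]
    ring
  rcases ht.eq_or_lt with rfl | ht'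
  · simp [hm]
  · rw [h1] at h0
    have := nonneg_of_mul_nonneg_right h0 ht'
    linarith

/-- A process indexed by the reals with almost surely continuous paths and locally bounded second
moments. -/
structure IsContinuousL2Process {Ω : Type*} [MeasurableSpace Ω] (P : Measure Ω)
    (w : ℝ → Ω → ℝ) : Prop where
  cont : ∀ᵐ ω ∂P, Continuous fun s ↦ w s ω
  memLp : ∀ s, MemLp (w s) 2 P
  bound : ∀ t, ∃ C : ℝ, ∀ s ∈ Set.Icc 0 t, ∫ ω, w s ω ^ 2 ∂P ≤ C

namespace IsContinuousL2Process

variable {Ω : Type*} [MeasurableSpace Ω] {P : Measure Ω} [IsProbabilityMeasure P]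
  {w : ℝ → Ω → ℝ}

theorem aemeasurable_uncurry (hw : IsContinuousL2Process P w) (μ : Measure ℝ) [SFinite μ] :
    AEMeasurable (fun p : ℝ × Ω ↦ w p.1 p.2) (μ.prod P) :=
  aemeasurable_uncurry_of_ae_continuous (fun s ↦ (hw.memLp s).1.aemeasurable) hw.cont μ

/-- Each time slice is integrable by `memLp`, and `bound` bounds the slice integrals uniformly on
the finite interval. -/
theorem integrable_prod_sq (hw : IsContinuousL2Process P w) {h : ℝ → ℝ} (hh : Continuous h)
    (t : ℝ) :
    Integrable (fun p : ℝ × Ω ↦ (h p.1 * w p.1 p.2) ^ 2)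
      ((volume.restrict (Set.Ioc 0 t)).prod P) := by
  have hm := ((hh.measurable.comp measurable_fst).aemeasurable.mul
    (hw.aemeasurable_uncurry (volume.restrict (Set.Ioc 0 t)))).pow_const 2
  refine (integrable_prod_iff hm.aestronglyMeasurable).2 ⟨.of_forall fun s ↦ ?_, ?_⟩
  · exact ((hw.memLp s).const_mul (h s)).integrable_sq
  · obtain ⟨C, hC⟩ := hw.bound t
    obtain ⟨D, hD⟩ := (isCompact_Icc (a := (0 : ℝ)) (b := t)).exists_bound_of_continuousOn
      hh.continuousOn
    refine Integrable.of_bound (C := D ^ 2 * C)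
      hm.aestronglyMeasurable.norm.integral_prod_right' ?_
    refine (ae_restrict_iff' measurableSet_Ioc).2 (.of_forall fun s hs ↦ ?_)
    have hs' := Set.Ioc_subset_Icc_self hs
    rw [Real.norm_of_nonneg (integral_nonneg fun _ ↦ norm_nonneg _)]
    have : ∀ ω, ‖(h s * w s ω) ^ 2‖ = h s ^ 2 * w s ω ^ 2 := fun ω ↦ by
      rw [Real.norm_of_nonneg (sq_nonneg _), mul_pow]
    simp only [Pi.mul_apply, Function.comp, this]
    rw [integral_const_mul]
    have h1 : h s ^ 2 ≤ D ^ 2 := sq_le_sq' (abs_le.1 (hD s hs')).1 (abs_le.1 (hD s hs')).2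
    exact mul_le_mul h1 (hC s hs') (integral_nonneg fun _ ↦ sq_nonneg _) (sq_nonneg _)

/-- Dominated by `U² + (h w)²`; this is the integrability that Fubini needs. -/
theorem integrable_prod_mul (hw : IsContinuousL2Process P w) {h : ℝ → ℝ} (hh : Continuous h)
    (t : ℝ) {U : Ω → ℝ} (hU : MemLp U 2 P) :
    Integrable (fun p : ℝ × Ω ↦ U p.2 * (h p.1 * w p.1 p.2))
      ((volume.restrict (Set.Ioc 0 t)).prod P) := by
  have hm := (hh.measurable.comp measurable_fst).aemeasurable.mul
    (hw.aemeasurable_uncurry (volume.restrict (Set.Ioc 0 t)))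
  have h1 := hU.integrable_sq.comp_snd (volume.restrict (Set.Ioc 0 t))
  have hUm := hU.1.comp_snd (μ := volume.restrict (Set.Ioc 0 t))
  refine (h1.add (hw.integrable_prod_sq hh t)).mono' (hUm.mul hm.aestronglyMeasurable)
    (.of_forall fun p ↦ ?_)
  simp only [Pi.add_apply, norm_mul, Real.norm_eq_abs]
  rw [← abs_mul (h p.1), ← sq_abs (U p.2), ← sq_abs (h p.1 * w p.1 p.2)]
  nlinarith [sq_nonneg (|U p.2| - |h p.1 * w p.1 p.2|), sq_nonneg (|U p.2|),
    sq_nonneg (|h p.1 * w p.1 p.2|)]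

theorem integral_mul_integral (hw : IsContinuousL2Process P w) {h : ℝ → ℝ} (hh : Continuous h)
    {t : ℝ} (ht : 0 ≤ t) {U : Ω → ℝ} (hU : MemLp U 2 P) :
    ∫ ω, U ω * (∫ s in (0 : ℝ)..t, h s * w s ω) ∂P
      = ∫ s in (0 : ℝ)..t, h s * ∫ ω, U ω * w s ω ∂P := by
  simp_rw [← intervalIntegral.integral_const_mul, ← integral_const_mul,
    intervalIntegral.integral_of_le ht]
  rw [← integral_integral_swap (hw.integrable_prod_mul hh t hU)]
  refine integral_congr_ae (.of_forall fun s ↦ ?_)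
  refine integral_congr_ae (.of_forall fun ω ↦ ?_)
  simp only
  ring

/-- Cauchy–Schwarz along each continuous path bounds the square by `t ∫₀ᵗ (h w)²`, which is
integrable over `Ω`. -/
theorem memLp_integral (hw : IsContinuousL2Process P w) {h : ℝ → ℝ} (hh : Continuous h)
    {t : ℝ} (ht : 0 ≤ t) : MemLp (fun ω ↦ ∫ s in (0 : ℝ)..t, h s * w s ω) 2 P := by
  have hm : AEStronglyMeasurable (fun ω ↦ ∫ s in (0 : ℝ)..t, h s * w s ω) P := by
    simp_rw [intervalIntegral.integral_of_le ht]
    have hm := (hh.measurable.comp measurable_fst).aemeasurable.mul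
      (hw.aemeasurable_uncurry (volume.restrict (Set.Ioc 0 t)))
    exact hm.aestronglyMeasurable.prod_swap.integral_prod_right'
  refine (memLp_two_iff_integrable_sq hm).2 ?_
  have hI := ((hw.integrable_prod_sq hh t).integral_prod_right).const_mul t
  refine hI.mono' (hm.pow 2) ?_
  filter_upwards [hw.cont] with ω hω
  rw [Real.norm_of_nonneg (sq_nonneg _), ← intervalIntegral.integral_of_le ht]
  exact sq_integral_le_mul_integral_sq ht (hh.mul hω)

end IsContinuousL2Process

/-! ### Wiener integrals and the Itô isometry -/

/-- The Wiener integral `∫₀ᵗ g dw` of a function `g` with derivative `g'`, defined pathwise through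
integration by parts for a process `w` starting at `0`. -/
noncomputable def wienerIntegral {Ω : Type*} (g g' : ℝ → ℝ) (w : ℝ → Ω → ℝ) (t : ℝ) (ω : Ω) : ℝ :=
  g t * w t ω - ∫ s in (0 : ℝ)..t, g' s * w s ω

section WienerIntegral

variable {Ω : Type*} [MeasurableSpace Ω] {P : Measure Ω} [IsProbabilityMeasure P]
  {w v : ℝ → Ω → ℝ} {g g' f f' : ℝ → ℝ} {t : ℝ}

theorem memLp_wienerIntegral (hw : IsContinuousL2Process P w) (hg' : Continuous g') (ht : 0 ≤ t) :
    MemLp (wienerIntegral g g' w t) 2 P :=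
  ((hw.memLp t).const_mul (g t)).sub (hw.memLp_integral hg' ht)

/-- Only the products `E(U w_s)` remain on the right. Taking `U` to be a constant, the integrator or
another Wiener integral yields all the moments needed. -/
theorem integral_mul_wienerIntegral (hw : IsContinuousL2Process P w) (hg' : Continuous g')
    (ht : 0 ≤ t) {U : Ω → ℝ} (hU : MemLp U 2 P) :
    ∫ ω, U ω * wienerIntegral g g' w t ω ∂P
      = g t * (∫ ω, U ω * w t ω ∂P) - ∫ s in (0 : ℝ)..t, g' s * ∫ ω, U ω * w s ω ∂P := by
  rw [← hw.integral_mul_integral hg' ht hU, ← integral_const_mul, ← integral_sub]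
  · refine integral_congr_ae (.of_forall fun ω ↦ ?_)
    simp only [wienerIntegral]
    ring
  · exact (hU.integrable_mul (hw.memLp t)).const_mul _
  · exact hU.integrable_mul (hw.memLp_integral hg' ht)

/-- A Wiener integral is orthogonal to everything the integrator is orthogonal to. -/
theorem integral_mul_wienerIntegral_eq_zero (hw : IsContinuousL2Process P w) (hg' : Continuous g')
    (ht : 0 ≤ t) {U : Ω → ℝ} (hU : MemLp U 2 P) (h0 : ∀ s, 0 ≤ s → ∫ ω, U ω * w s ω ∂P = 0) :
    ∫ ω, U ω * wienerIntegral g g' w t ω ∂P = 0 := by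
  rw [integral_mul_wienerIntegral hw hg' ht hU, h0 t ht, mul_zero, zero_sub, neg_eq_zero]
  refine (intervalIntegral.integral_congr (g := fun _ ↦ 0) fun s hs ↦ ?_).trans (by simp)
  rw [Set.uIcc_of_le ht] at hs
  simp [h0 s hs.1]

/-- The preceding orthogonality is applied twice, once to each factor. -/
theorem integral_wienerIntegral_mul_wienerIntegral_eq_zero (hw : IsContinuousL2Process P w)
    (hv : IsContinuousL2Process P v) (hg' : Continuous g') (hf' : Continuous f') (ht : 0 ≤ t)
    (h0 : ∀ r s, 0 ≤ r → 0 ≤ s → ∫ ω, v r ω * w s ω ∂P = 0) :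
    ∫ ω, wienerIntegral f f' v t ω * wienerIntegral g g' w t ω ∂P = 0 := by
  refine integral_mul_wienerIntegral_eq_zero hw hg' ht (memLp_wienerIntegral hv hf' ht)
    fun s hs ↦ ?_
  simp_rw [mul_comm _ (w s _)]
  refine integral_mul_wienerIntegral_eq_zero hv hf' ht (hw.memLp s) fun r hr ↦ ?_
  simp_rw [mul_comm (w s _)]
  exact h0 r s hr hs

/-- The covariance of the integrator with a Wiener integral. -/
theorem integral_mul_wienerIntegral_of_cov_min (hw : IsContinuousL2Process P w)
    (hcov : ∀ r s, 0 ≤ r → 0 ≤ s → ∫ ω, w r ω * w s ω ∂P = min r s)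
    (hg : ∀ s, HasDerivAt g (g' s) s) (hg' : Continuous g') {r : ℝ} (hr : 0 ≤ r) (hrt : r ≤ t) :
    ∫ ω, w r ω * wienerIntegral g g' w t ω ∂P = ∫ s in (0 : ℝ)..r, g s := by
  have hgc : Continuous g := continuous_iff_continuousAt.2 fun s ↦ (hg s).continuousAt
  have ht : 0 ≤ t := hr.trans hrt
  rw [integral_mul_wienerIntegral hw hg' ht (hw.memLp r), hcov r t hr ht, min_eq_left hrt]
  have e : ∫ s in (0 : ℝ)..t, g' s * ∫ ω, w r ω * w s ω ∂P
      = ∫ s in (0 : ℝ)..t, g' s * min r s := by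
    refine intervalIntegral.integral_congr fun s hs ↦ ?_
    rw [Set.uIcc_of_le ht] at hs
    simp only [hcov r s hr hs.1]
  have hi : ∀ a b, IntervalIntegrable (fun s ↦ g' s * min r s) volume a b := fun a b ↦
    Continuous.intervalIntegrable (by fun_prop) a b
  -- The kernel `min r s` is `s` before `r` and `r` after it.
  rw [e, ← intervalIntegral.integral_add_adjacent_intervals (hi 0 r) (hi r t)]
  have e1 : ∫ s in (0 : ℝ)..r, g' s * min r s = r * g r - ∫ s in (0 : ℝ)..r, g s := by
    have h1 : ∫ s in (0 : ℝ)..r, g' s * min r s = ∫ s in (0 : ℝ)..r, s * g' s := by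
      refine intervalIntegral.integral_congr fun s hs ↦ ?_
      rw [Set.uIcc_of_le hr] at hs
      simp only [min_eq_right hs.2]
      ring
    rw [h1, intervalIntegral.integral_mul_deriv_eq_deriv_mul (u := fun s ↦ s) (u' := fun _ ↦ 1)
      (fun s _ ↦ hasDerivAt_id s) (fun s _ ↦ hg s) (by simp) (hg'.intervalIntegrable _ _)]
    simp
  have e2 : ∫ s in r..t, g' s * min r s = (g t - g r) * r := by
    have h1 : ∫ s in r..t, g' s * min r s = ∫ s in r..t, g' s * r := by
      refine intervalIntegral.integral_congr fun s hs ↦ ?_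
      rw [Set.uIcc_of_le hrt] at hs
      simp only [min_eq_left hs.1]
    rw [h1, intervalIntegral.integral_mul_const,
      intervalIntegral.integral_eq_sub_of_hasDerivAt (fun s _ ↦ hg s)
        (hg'.intervalIntegrable _ _)]
  rw [e1, e2]
  ring

/-- The Itô isometry for Wiener integrals of continuously differentiable functions. -/
theorem integral_wienerIntegral_sq (hw : IsContinuousL2Process P w)
    (hcov : ∀ r s, 0 ≤ r → 0 ≤ s → ∫ ω, w r ω * w s ω ∂P = min r s)
    (hg : ∀ s, HasDerivAt g (g' s) s) (hg' : Continuous g') (ht : 0 ≤ t) :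
    ∫ ω, wienerIntegral g g' w t ω ^ 2 ∂P = ∫ s in (0 : ℝ)..t, g s ^ 2 := by
  have hgc : Continuous g := continuous_iff_continuousAt.2 fun s ↦ (hg s).continuousAt
  have h1 : ∀ s ∈ Set.Icc 0 t, ∫ ω, wienerIntegral g g' w t ω * w s ω ∂P
      = ∫ u in (0 : ℝ)..s, g u := fun s hs ↦ by
    simp_rw [mul_comm _ (w s _)]
    exact integral_mul_wienerIntegral_of_cov_min hw hcov hg hg' hs.1 hs.2
  simp_rw [pow_two]
  rw [integral_mul_wienerIntegral hw hg' ht (memLp_wienerIntegral hw hg' ht),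
    h1 t ⟨ht, le_rfl⟩]
  have e : ∫ s in (0 : ℝ)..t, g' s * ∫ ω, wienerIntegral g g' w t ω * w s ω ∂P
      = ∫ s in (0 : ℝ)..t, (∫ u in (0 : ℝ)..s, g u) * g' s := by
    refine intervalIntegral.integral_congr fun s hs ↦ ?_
    rw [Set.uIcc_of_le ht] at hs
    simp only [h1 s hs]
    ring
  -- With `G(s) = ∫₀ˢ g`, the second moment is `g(t) G(t) - ∫₀ᵗ G g'`, and integration by parts
  -- leaves `∫₀ᵗ g²`.
  rw [e, intervalIntegral.integral_mul_deriv_eq_deriv_mul (u := fun s ↦ ∫ u in (0 : ℝ)..s, g u)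
    (fun s _ ↦ intervalIntegral.integral_hasDerivAt_right (hgc.intervalIntegrable _ _)
      hgc.aestronglyMeasurable.stronglyMeasurableAtFilter hgc.continuousAt)
    (fun s _ ↦ hg s) (hgc.intervalIntegrable _ _) (hg'.intervalIntegrable _ _)]
  simp
  ring

end WienerIntegral

/-! ### Moments of Brownian motion -/

theorem integral_mul_of_isBrownianReal {Ω : Type*} [MeasurableSpace Ω] {P : Measure Ω}
    {b : ℝ≥0 → Ω → ℝ} (hb : IsBrownianReal b P) {r s : ℝ} (hr : 0 ≤ r) (hs : 0 ≤ s) :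
    ∫ ω, b r.toNNReal ω * b s.toNNReal ω ∂P = min r s := by
  have := hb.isGaussianProcess.isProbabilityMeasure
  have h := hb.covariance_eval r.toNNReal s.toNNReal
  rw [covariance_eq_sub (hb.isGaussianProcess.hasGaussianLaw_eval _).memLp_two
    (hb.isGaussianProcess.hasGaussianLaw_eval _).memLp_two, hb.integral_eval] at h
  simpa [Real.coe_toNNReal _ hr, Real.coe_toNNReal _ hs] using h

theorem isContinuousL2Process_of_isBrownianReal {Ω : Type*} [MeasurableSpace Ω] {P : Measure Ω}
    {b : ℝ≥0 → Ω → ℝ} (hb : IsBrownianReal b P) :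
    IsContinuousL2Process P fun s ω ↦ b s.toNNReal ω where
  cont := by
    filter_upwards [hb.cont] with ω hω
    exact hω.comp continuous_real_toNNReal
  memLp s := (hb.isGaussianProcess.hasGaussianLaw_eval _).memLp_two
  bound t := ⟨t, fun s hs ↦ by
    have h := integral_mul_of_isBrownianReal hb hs.1 hs.1
    simp_rw [← pow_two, min_self] at h
    exact h.trans_le hs.2⟩

/-! ### Matrix exponentials and variation of constants -/

variable {n d : ℕ}

/-- The entries of `e^{(t-s)L} B`. -/
noncomputable def expMulEntry (L : Matrix (Fin n) (Fin n) ℝ) (B : Matrix (Fin n) (Fin d) ℝ) (t : ℝ)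
    (i : Fin n) (j : Fin d) (s : ℝ) : ℝ :=
  (NormedSpace.exp ((t - s) • L) * B) i j

theorem continuous_exp_entry (L : Matrix (Fin n) (Fin n) ℝ) (t : ℝ) (i m : Fin n) :
    Continuous fun s : ℝ ↦ NormedSpace.exp ((t - s) • L) i m :=
  continuous_iff_continuousAt.2 fun s ↦ (hasDerivAt_exp_entry t L i m s).continuousAt

theorem continuous_expMulEntry (L : Matrix (Fin n) (Fin n) ℝ) (B : Matrix (Fin n) (Fin d) ℝ)
    (t : ℝ) (i : Fin n) (j : Fin d) : Continuous (expMulEntry L B t i j) := by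
  have : expMulEntry L B t i j = fun s ↦ ∑ m, NormedSpace.exp ((t - s) • L) i m * B m j := by
    ext s; exact Matrix.mul_apply
  rw [this]
  exact continuous_finsetSum _ fun m _ ↦ (continuous_exp_entry L t i m).mul continuous_const

/-- Differentiation in `s` stays within the family, with `-L * B` in place of `B`; this supplies the
`g'` of the Wiener integrals. -/
theorem hasDerivAt_expMulEntry (L : Matrix (Fin n) (Fin n) ℝ) (B : Matrix (Fin n) (Fin d) ℝ)
    (t : ℝ) (i : Fin n) (j : Fin d) (s : ℝ) :
    HasDerivAt (expMulEntry L B t i j) (-expMulEntry L (L * B) t i j s) s := by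
  have h := HasDerivAt.fun_sum (u := Finset.univ) fun (m : Fin n) _ ↦
    (hasDerivAt_exp_entry t L i m s).mul_const (B m j)
  refine (h.congr_deriv ?_).congr_of_eventuallyEq (.of_forall fun s ↦ Matrix.mul_apply)
  rw [expMulEntry, ← Matrix.mul_assoc, Matrix.mul_apply]
  simp [Finset.sum_neg_distrib]

theorem expMulEntry_self (L : Matrix (Fin n) (Fin n) ℝ) (B : Matrix (Fin n) (Fin d) ℝ)
    (t : ℝ) (i : Fin n) (j : Fin d) : expMulEntry L B t i j t = B i j := by
  simp [expMulEntry]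

/-- Since `B` is constant it passes under the integral, exhibiting the entries as the cosine
coefficients in Parseval's identity. -/
theorem phiCos_mul_apply (L : Matrix (Fin n) (Fin n) ℝ) (B : Matrix (Fin n) (Fin d) ℝ) (k : ℕ)
    (t : ℝ) (i : Fin n) (j : Fin d) :
    (phiCos k t L * B) i j
      = ∫ s in (0 : ℝ)..t, expMulEntry L B t i j s * Real.cos (klFreq k * s) := by
  rw [Matrix.mul_apply]
  simp only [phiCos, Matrix.of_apply, expMulEntry, Matrix.mul_apply, Finset.sum_mul]
  have hc : ∀ m, Continuous fun s : ℝ ↦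
      NormedSpace.exp ((t - s) • L) i m * B m j * Real.cos (klFreq k * s) := fun m ↦
    ((continuous_exp_entry L t i m).mul continuous_const).mul (by fun_prop)
  rw [intervalIntegral.integral_finsetSum fun m _ ↦ (hc m).intervalIntegrable _ _]
  refine Finset.sum_congr rfl fun m _ ↦ ?_
  rw [← intervalIntegral.integral_mul_const]
  refine intervalIntegral.integral_congr fun s _ ↦ ?_
  ring

theorem frobNorm_sq (A : Matrix (Fin n) (Fin d) ℝ) : frobNorm A ^ 2 = ∑ i, ∑ j, A i j ^ 2 := by
  rw [frobNorm, Matrix.frobenius_norm_def, ← Real.sqrt_eq_rpow, Real.sq_sqrt]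
  · simp
  · exact Finset.sum_nonneg fun i _ ↦ Finset.sum_nonneg fun j _ ↦ by positivity

/-- Variation of constants for `y = x₀ + ∫ L y + B v` with a continuous forcing `v`. -/
theorem variation_of_constants (L : Matrix (Fin n) (Fin n) ℝ) (B : Matrix (Fin n) (Fin d) ℝ)
    (x₀ : EuclideanSpace ℝ (Fin n)) {y : ℝ → EuclideanSpace ℝ (Fin n)}
    {v : ℝ → EuclideanSpace ℝ (Fin d)} (hy : Continuous y) (hv : Continuous v) {t : ℝ}
    (ht : 0 ≤ t)
    (h : ∀ s ∈ Set.Icc 0 t, y s = x₀ + (∫ u in (0 : ℝ)..s, Matrix.toEuclideanLin L (y u))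
      + Matrix.toEuclideanLin B (v s)) (i : Fin n) :
    y t i = Matrix.toEuclideanLin (NormedSpace.exp (t • L)) x₀ i
      + ∑ j, (B i j * v t j + ∫ s in (0 : ℝ)..t, expMulEntry L (L * B) t i j s * v s j) := by
  have hLy : Continuous fun u ↦ Matrix.toEuclideanLin L (y u) :=
    (LinearMap.continuous_of_finiteDimensional _).comp hy
  -- `Y = y - B v` on `[0, t]` is differentiable even where the forcing is not: `Y' = L Y + L B v`.
  -- Hence `e^{(t-s)L} Y` has derivative `e^{(t-s)L} L B v`, with no derivative of `v`.
  set Y : ℝ → EuclideanSpace ℝ (Fin n) :=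
    fun s ↦ x₀ + ∫ u in (0 : ℝ)..s, Matrix.toEuclideanLin L (y u) with hY
  have hYd : ∀ s, HasDerivAt Y (Matrix.toEuclideanLin L (y s)) s := fun s ↦
    (intervalIntegral.integral_hasDerivAt_right (hLy.intervalIntegrable _ _)
      hLy.aestronglyMeasurable.stronglyMeasurableAtFilter hLy.continuousAt).const_add x₀
  have hYm : ∀ m s, HasDerivAt (fun s ↦ Y s m) (Matrix.toEuclideanLin L (y s) m) s := fun m s ↦
    ((EuclideanSpace.proj m : EuclideanSpace ℝ (Fin n) →L[ℝ] ℝ).hasFDerivAt).comp_hasDerivAt s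
      (hYd s)
  have hvj : ∀ j, Continuous fun s ↦ v s j := fun j ↦ by fun_prop
  have hF : ∀ s ∈ Set.uIcc 0 t,
      HasDerivAt (fun s ↦ ∑ m, NormedSpace.exp ((t - s) • L) i m * Y s m)
        (∑ j, expMulEntry L (L * B) t i j s * v s j) s := fun s hs ↦ by
    rw [Set.uIcc_of_le ht] at hs
    have hd := HasDerivAt.fun_sum (u := Finset.univ) fun (m : Fin n) _ ↦
      (hasDerivAt_exp_entry t L i m s).mul (hYm m s)
    refine hd.congr_deriv ?_
    have e : (y s).ofLp = (Y s).ofLp + B.mulVec (v s).ofLp := by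
      rw [h s hs]
      rfl
    have e1 : ∀ m, Matrix.toEuclideanLin L (y s) m
        = (L.mulVec (Y s).ofLp) m + ((L * B).mulVec (v s).ofLp) m := fun m ↦ by
      change (L.mulVec (y s).ofLp) m = _
      rw [e, Matrix.mulVec_add, Matrix.mulVec_mulVec]
      rfl
    simp_rw [e1]
    have e2 : ∑ j, expMulEntry L (L * B) t i j s * v s j
        = ((NormedSpace.exp ((t - s) • L)).mulVec ((L * B).mulVec (v s).ofLp)) i := by
      rw [Matrix.mulVec_mulVec]
      rfl
    have e3 : ∑ m, (NormedSpace.exp ((t - s) • L) * L) i m * Y s m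
        = ((NormedSpace.exp ((t - s) • L)).mulVec (L.mulVec (Y s).ofLp)) i := by
      rw [Matrix.mulVec_mulVec]
      rfl
    simp_rw [mul_add, neg_mul]
    rw [Finset.sum_add_distrib, Finset.sum_add_distrib, Finset.sum_neg_distrib, e2, e3]
    change _ + (((NormedSpace.exp ((t - s) • L)).mulVec (L.mulVec (Y s).ofLp)) i
      + ((NormedSpace.exp ((t - s) • L)).mulVec ((L * B).mulVec (v s).ofLp)) i) = _
    ring
  have hc : ∀ j, Continuous fun s ↦ expMulEntry L (L * B) t i j s * v s j := fun j ↦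
    (continuous_expMulEntry L (L * B) t i j).mul (hvj j)
  have hint := intervalIntegral.integral_eq_sub_of_hasDerivAt hF
    ((continuous_finsetSum _ fun j _ ↦ hc j).intervalIntegrable _ _)
  rw [intervalIntegral.integral_finsetSum fun j _ ↦ (hc j).intervalIntegrable _ _] at hint
  have hYt : ∑ m, NormedSpace.exp ((t - t) • L) i m * Y t m = Y t i := by
    simp [Matrix.one_apply]
  have hY0 : ∑ m, NormedSpace.exp ((t - 0) • L) i m * Y 0 m
      = Matrix.toEuclideanLin (NormedSpace.exp (t • L)) x₀ i := by
    rw [sub_zero, show Y 0 = x₀ by simp [hY]]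
    rfl
  rw [hYt, hY0] at hint
  have hyt : y t i = Y t i + ∑ j, B i j * v t j := by
    rw [h t ⟨ht, le_rfl⟩]
    rfl
  rw [Finset.sum_add_distrib, hint, hyt]
  ring

/-! ### The solution as a Wiener integral, and its moments -/

/-- The solution of the linear equation is a sum of Wiener integrals. -/
theorem ae_eq_sum_wienerIntegral {Ω : Type*} [MeasurableSpace Ω] {P : Measure Ω}
    {L : Matrix (Fin n) (Fin n) ℝ} {B : Matrix (Fin n) (Fin d) ℝ}
    {W : ℝ≥0 → Ω → EuclideanSpace ℝ (Fin d)} (hW : IsStandardWiener P W)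
    {x₀ : EuclideanSpace ℝ (Fin n)} {X : ℝ≥0 → Ω → EuclideanSpace ℝ (Fin n)}
    (hX : IsLinearSDESolution P L B W x₀ X) (t : ℝ≥0) :
    ∀ᵐ ω ∂P, ∀ i, X t ω i = Matrix.toEuclideanLin (NormedSpace.exp ((t : ℝ) • L)) x₀ i
      + ∑ j, wienerIntegral (expMulEntry L B t i j) (fun s ↦ -expMulEntry L (L * B) t i j s)
        (fun s ω ↦ W s.toNNReal ω j) t ω := by
  filter_upwards [hX.cont, hX.eqn, ae_all_iff.2 fun j ↦ (hW.brownian j).cont,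
    ae_all_iff.2 fun j ↦ (hW.brownian j).eval_zero_ae_eq_zero] with ω hc he hWc hW0 i
  have hW0' : W 0 ω = 0 := by ext j; exact hW0 j
  have hWc' : Continuous fun s ↦ W s ω :=
    (PiLp.continuous_toLp 2 (fun _ : Fin d ↦ ℝ)).comp (continuous_pi hWc)
  have h := variation_of_constants L B x₀ (y := fun s ↦ X s.toNNReal ω)
    (v := fun s ↦ W s.toNNReal ω) (hc.comp continuous_real_toNNReal)
    (hWc'.comp continuous_real_toNNReal) t.coe_nonneg (fun s hs ↦ by
      have := he s.toNNReal
      rwa [Real.coe_toNNReal _ hs.1, hW0', sub_zero] at this) i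
  simp only [Real.toNNReal_coe] at h
  rw [h]
  congr 1
  refine Finset.sum_congr rfl fun j _ ↦ ?_
  simp [wienerIntegral, expMulEntry_self]

/-- Distinct components of a standard Wiener process are uncorrelated at all pairs of times. -/
theorem IsStandardWiener.integral_mul_eq_zero {Ω : Type*} [MeasurableSpace Ω] {d : ℕ}
    {P : Measure Ω} {W : ℝ≥0 → Ω → EuclideanSpace ℝ (Fin d)} (hW : IsStandardWiener P W)
    {j k : Fin d} (hjk : j ≠ k) (r s : ℝ≥0) : ∫ ω, W r ω j * W s ω k ∂P = 0 := by
  have h : IndepFun (fun ω ↦ W r ω j) (fun ω ↦ W s ω k) P :=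
    (hW.indep.indepFun hjk).comp (measurable_pi_apply r) (measurable_pi_apply s)
  rw [h.integral_fun_mul_eq_mul_integral ((hW.brownian j).integrable_eval r).1
    ((hW.brownian k).integrable_eval s).1, (hW.brownian j).integral_eval, zero_mul]

/-- The second moment of a constant plus a sum of centered, pairwise uncorrelated variables. -/
theorem integral_const_add_sum_sq {Ω ι : Type*} [MeasurableSpace Ω] {P : Measure Ω}
    [IsProbabilityMeasure P] [Fintype ι] {Z : ι → Ω → ℝ} (hZ : ∀ j, MemLp (Z j) 2 P)
    (h0 : ∀ j, ∫ ω, Z j ω ∂P = 0) (horth : ∀ j k, j ≠ k → ∫ ω, Z j ω * Z k ω ∂P = 0) (c : ℝ) :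
    ∫ ω, (c + ∑ j, Z j ω) ^ 2 ∂P = c ^ 2 + ∑ j, ∫ ω, Z j ω ^ 2 ∂P := by
  have hi : ∀ j, Integrable (Z j) P := fun j ↦ (hZ j).integrable one_le_two
  have hij : ∀ j k, Integrable (fun ω ↦ Z j ω * Z k ω) P := fun j k ↦ (hZ j).integrable_mul (hZ k)
  have e : ∀ ω, (c + ∑ j, Z j ω) ^ 2
      = c ^ 2 + 2 * c * ∑ j, Z j ω + ∑ j, ∑ k, Z j ω * Z k ω := fun ω ↦ by
    rw [← Finset.sum_mul_sum]; ring
  have hs : Integrable (fun ω ↦ 2 * c * ∑ j, Z j ω) P :=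
    (integrable_finsetSum _ fun j _ ↦ hi j).const_mul _
  have hss : Integrable (fun ω ↦ ∑ j, ∑ k, Z j ω * Z k ω) P :=
    integrable_finsetSum _ fun j _ ↦ integrable_finsetSum _ fun k _ ↦ hij j k
  have hcs : Integrable (fun ω ↦ c ^ 2 + 2 * c * ∑ j, Z j ω) P := (integrable_const _).add hs
  simp_rw [e]
  rw [integral_add hcs hss, integral_add (integrable_const _) hs,
    integral_const_mul, integral_finsetSum _ fun j _ ↦ hi j, integral_finsetSum _ fun j _ ↦
      integrable_finsetSum _ fun k _ ↦ hij j k]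
  have h1 : ∀ j, ∫ ω, ∑ k, Z j ω * Z k ω ∂P = ∫ ω, Z j ω ^ 2 ∂P := fun j ↦ by
    rw [integral_finsetSum _ fun k _ ↦ hij j k, Finset.sum_eq_single j
      (fun k _ hk ↦ horth j k hk.symm) (by simp)]
    simp_rw [pow_two]
  simp [h0, h1]

theorem theorem4 {Ω : Type*} [MeasurableSpace Ω] (P : Measure Ω) [IsProbabilityMeasure P]
    {n d : ℕ} (L : Matrix (Fin n) (Fin n) ℝ) (B : Matrix (Fin n) (Fin d) ℝ)
    (W : ℝ≥0 → Ω → EuclideanSpace ℝ (Fin d)) (hW : IsStandardWiener P W)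
    (x₀ : EuclideanSpace ℝ (Fin n)) (X : ℝ≥0 → Ω → EuclideanSpace ℝ (Fin n))
    (hX : IsLinearSDESolution P L B W x₀ X) (t : ℝ≥0) (ht : t ≤ 1) :
    (Integrable (X t) P ∧
      ∫ ω, X t ω ∂P = Matrix.toEuclideanLin (NormedSpace.exp ((t : ℝ) • L)) x₀) ∧
    (Integrable (fun ω ↦ ‖X t ω‖ ^ 2) P ∧
      Summable (fun k : ℕ ↦ frobNorm (phiCos (k + 1) (t : ℝ) L * B) ^ 2) ∧
      ∫ ω, ‖X t ω‖ ^ 2 ∂P =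
        ‖Matrix.toEuclideanLin (NormedSpace.exp ((t : ℝ) • L)) x₀‖ ^ 2
          + 2 * ∑' k : ℕ, frobNorm (phiCos (k + 1) (t : ℝ) L * B) ^ 2) := by
  have ht0 : (0 : ℝ) ≤ t := t.coe_nonneg
  set c := Matrix.toEuclideanLin (NormedSpace.exp ((t : ℝ) • L)) x₀ with hc
  set w : Fin d → ℝ → Ω → ℝ := fun j s ω ↦ W s.toNNReal ω j with hw
  have hwp : ∀ j, IsContinuousL2Process P (w j) := fun j ↦
    isContinuousL2Process_of_isBrownianReal (hW.brownian j)
  set Z : Fin n → Fin d → Ω → ℝ := fun i j ↦ wienerIntegral (expMulEntry L B t i j)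
    (fun s ↦ -expMulEntry L (L * B) t i j s) (w j) t with hZdef
  have hae : ∀ᵐ ω ∂P, ∀ i, X t ω i = c i + ∑ j, Z i j ω := ae_eq_sum_wienerIntegral hW hX t
  have hg' : ∀ i j, Continuous fun s ↦ -expMulEntry L (L * B) t i j s := fun i j ↦
    (continuous_expMulEntry L (L * B) t i j).neg
  have hZ : ∀ i j, MemLp (Z i j) 2 P := fun i j ↦ memLp_wienerIntegral (hwp j) (hg' i j) ht0
  -- Orthogonality against `U = 1`: the integrator is centred.
  have hZ0 : ∀ i j, ∫ ω, Z i j ω ∂P = 0 := fun i j ↦ by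
    simpa using integral_mul_wienerIntegral_eq_zero (g := expMulEntry L B t i j) (hwp j) (hg' i j)
      ht0 (memLp_const (1 : ℝ)) (fun s _ ↦ by
        simpa using (hW.brownian j).integral_eval s.toNNReal)
  have hZorth : ∀ i j k, j ≠ k → ∫ ω, Z i j ω * Z i k ω ∂P = 0 := fun i j k hjk ↦
    integral_wienerIntegral_mul_wienerIntegral_eq_zero (hwp k) (hwp j) (hg' i k) (hg' i j) ht0
      fun r s _ _ ↦ hW.integral_mul_eq_zero hjk _ _
  have hZsq : ∀ i j, ∫ ω, Z i j ω ^ 2 ∂P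
      = ∫ s in (0 : ℝ)..t, expMulEntry L B t i j s ^ 2 := fun i j ↦
    integral_wienerIntegral_sq (hwp j)
      (fun r s hr hs ↦ integral_mul_of_isBrownianReal (hW.brownian j) hr hs)
      (hasDerivAt_expMulEntry L B t i j) (hg' i j) ht0
  -- Measurability of `X t` is not assumed; it is inherited from the almost sure representation.
  have hXL : ∀ i, MemLp (fun ω ↦ X t ω i) 2 P := fun i ↦
    ((memLp_const (c i)).add (memLp_finsetSum _ fun j _ ↦ hZ i j)).ae_eq
      (hae.mono fun ω h ↦ by simpa using (h i).symm)
  have hXi : ∀ i, Integrable (fun ω ↦ X t ω i) P := fun i ↦ (hXL i).integrable one_le_two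
  have hnorm : ∀ x : EuclideanSpace ℝ (Fin n), ‖x‖ ^ 2 = ∑ i, x i ^ 2 := fun x ↦ by
    simp [EuclideanSpace.norm_sq_eq]
  -- Parseval entry by entry; the `1 / 2` here cancels the factor `2` before the series.
  have hsum : HasSum (fun k : ℕ ↦ frobNorm (phiCos (k + 1) (t : ℝ) L * B) ^ 2)
      (∑ i, ∑ j, 1 / 2 * ∫ s in (0 : ℝ)..t, expMulEntry L B t i j s ^ 2) := by
    simp_rw [frobNorm_sq, phiCos_mul_apply]
    exact hasSum_sum fun i _ ↦ hasSum_sum fun j _ ↦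
      hasSum_sq_integral_cos_klFreq (continuous_expMulEntry L B t i j) ht0 ht
  refine ⟨⟨Integrable.of_eval_piLp hXi, ?_⟩, ?_, hsum.summable, ?_⟩
  · ext i
    rw [eval_integral_piLp hXi, integral_congr_ae (hae.mono fun ω h ↦ h i),
      integral_add (integrable_const _)
        (integrable_finsetSum _ fun j _ ↦ (hZ i j).integrable one_le_two),
      integral_finsetSum _ fun j _ ↦ (hZ i j).integrable one_le_two]
    simp [hZ0]
  · simp_rw [hnorm]
    exact integrable_finsetSum _ fun i _ ↦ (hXL i).integrable_sq
  · rw [hsum.tsum_eq]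
    simp_rw [hnorm]
    rw [integral_finsetSum _ fun i _ ↦ (hXL i).integrable_sq, Finset.mul_sum,
      ← Finset.sum_add_distrib]
    refine Finset.sum_congr rfl fun i _ ↦ ?_
    rw [integral_congr_ae (hae.mono fun ω h ↦ congrArg (· ^ 2) (h i)),
      integral_const_add_sum_sq (hZ i) (hZ0 i) (hZorth i), ← Finset.mul_sum]
    simp_rw [hZsq]
    ring
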